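/- Let $F$ be a field of characteristic $\neq 2$, let $F^s$ be a separable closure of $F$, and let $a,b,c\in F^*$. Let $X(a,b,c)$ be the closed subscheme of $\mathbb{G}_m\times\mathbb{A}^4$ over $F$ given by $$b x^2=(y_1^2-a y_2^2+c y_3^2-ac\,y_4^2)^2-c\,(2y_1y_3-2a\,y_2y_4)^2,$$ where $x$ is the coordinate on $\mathbb{G}_m$ and $y_1,\dots,y_4$ are the coordinates on $\mathbb{A}^4$; the right-hand side is the norm of $y_1+y_2\sqrt a+y_3\sqrt c+y_4\sqrt a\sqrt c$, that is, $\prod_{i,j\in\{0,1\}}\bigl(y_1+(-1)^iy_2\sqrt a+(-1)^jy_3\sqrt c+(-1)^{i+j}y_4\sqrt a\sqrt c\bigr)$. Let $\mathcal{C}^*$ be the differential graded algebra of inhomogeneous continuous $\mathbb{Z}/2$-valued cochains of $\operatorname{Gal}(F^s/F)$, with differential $\delta$, cup product $\cup$ and cohomology $H^*(\operatorname{Gal}(F^s/F),\mathbb{Z}/2)$, and let $\kappa: F^*\to H^1(\operatorname{Gal}(F^s/F),\mathbb{Z}/2)$ be the Kummer map, which sends $a$ to the class of $g\mapsto g(\sqrt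 a)/\sqrt a\in\{\pm1\}\cong\mathbb{Z}/2$. For $\alpha_1,\alpha_2,\alpha_3\in H^1$, a defining system consists of $a_{12},a_{23},a_{34},a_{13},a_{24}\in\mathcal{C}^1$ such that $a_{12},a_{23},a_{34}$ are cocycles representing $\alpha_1,\alpha_2,\alpha_3$ respectively, $\delta a_{13}=a_{12}\cup a_{23}$ and $\delta a_{24}=a_{23}\cup a_{34}$. The triple Massey product $\langle\alpha_1,\alpha_2,\alpha_3\rangle$ is defined if a defining system exists, and it is the set of the classes of $a_{12}\cup a_{24}+a_{13}\cup a_{34}$ in $H^2(\operatorname{Gal}(F^s/F),\mathbb{Z}/2)$ over all defining systems. Then $X(a,b,c)$ has an $F$-point if and only if $\langle\kappa(a),\kappa(b),\kappa(c)\rangle$ is defined and contains $0$. -/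

import Mathlib

open CategoryTheory AlgebraicGeometry

/-! ### Continuous cochains with coefficients in `ℤ/2` (trivial action) -/

namespace ContCochain

section

variable (G : Type*) [Group G] [TopologicalSpace G] [IsTopologicalGroup G]

/-- Inhomogeneous continuous `n`-cochains of `G` with values in the discrete group `ℤ/2`. -/
abbrev Cochain (n : ℕ) : Type _ := C(Fin n → G, ZMod 2)

/-- The differential `δ : 𝒞ⁿ → 𝒞ⁿ⁺¹`,
`(δ f)(g₁, …, gₙ₊₁) = f(g₂, …, gₙ₊₁) + ∑_{j=1}^{n} (-1)^j f(g₁, …, gⱼ gⱼ₊₁, …, gₙ₊₁)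
  + (-1)^{n+1} f(g₁, …, gₙ)`.
The index `j` below is shifted by one, and contracting at the last index drops the last entry. -/
def d (n : ℕ) : Cochain G n →ₗ[ZMod 2] Cochain G (n + 1) where
  toFun f :=
    { toFun := fun g => f (fun i => g i.succ) +
        ∑ j : Fin (n + 1), (-1 : ZMod 2) ^ ((j : ℕ) + 1) * f (Fin.contractNth j (· * ·) g)
      continuous_toFun := by
        refine (f.continuous.comp (by fun_prop)).add
          (continuous_finsetSum _ fun j _ =>
            (continuous_of_discreteTopology (f := fun t : ZMod 2 => (-1) ^ ((j : ℕ) + 1) * t)).comp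
              (f.continuous.comp ?_))
        refine continuous_pi fun k => ?_
        unfold Fin.contractNth
        split_ifs <;> fun_prop }
  map_add' f f' := by
    ext g
    simp [mul_add, Finset.sum_add_distrib, add_add_add_comm]
  map_smul' r f := by
    ext g
    simp [mul_add, Finset.mul_sum, mul_left_comm]

/-- The `n`-cocycles. -/
def cocycles (n : ℕ) : Submodule (ZMod 2) (Cochain G n) := LinearMap.ker (d G n)

/-- The `n`-coboundaries. -/
def coboundaries : (n : ℕ) → Submodule (ZMod 2) (Cochain G n)
  | 0 => ⊥
  | n + 1 => LinearMap.range (d G n)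

/-- The continuous cohomology group `Hⁿ(G, ℤ/2) = ker δ / im δ`. -/
abbrev H (n : ℕ) : Type _ := cocycles G n ⧸ (coboundaries G n).submoduleOf (cocycles G n)

end

section

variable {G : Type*} [Group G] [TopologicalSpace G] [IsTopologicalGroup G]

/-- The cohomology class of a cocycle. -/
def classOf {n : ℕ} (z : cocycles G n) : H G n := Submodule.Quotient.mk z

/-- The cup product of cochains:
`(f ∪ f')(g₁, …, gₚ₊ₖ) = f(g₁, …, gₚ) f'(gₚ₊₁, …, gₚ₊ₖ)`. -/
def cup {p q : ℕ} (f : Cochain G p) (f' : Cochain G q) : Cochain G (p + q) where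
  toFun g := f (fun i => g (Fin.castAdd q i)) * f' (fun i => g (Fin.natAdd p i))
  continuous_toFun := by fun_prop

theorem d_one_apply (f : Cochain G 1) (g : Fin 2 → G) :
    d G 1 f g = f ![g 0] + f ![g 1] + f ![g 0 * g 1] := by
  have h0 : (fun i : Fin 1 => g i.succ) = ![g 1] := by ext i; fin_cases i; rfl
  have h1 : Fin.contractNth (0 : Fin 2) (· * ·) g = ![g 0 * g 1] := by
    ext i; fin_cases i; rfl
  have h2 : Fin.contractNth (1 : Fin 2) (· * ·) g = ![g 0] := by ext i; fin_cases i; rfl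
  have e : (-1 : ZMod 2) = 1 := by decide
  change f (fun i : Fin 1 => g i.succ) + ∑ j : Fin 2,
    (-1 : ZMod 2) ^ ((j : ℕ) + 1) * f (Fin.contractNth j (· * ·) g) = _
  rw [Fin.sum_univ_two, h0, h1, h2, e]
  ring

theorem d_two_apply (f : Cochain G 2) (g : Fin 3 → G) :
    d G 2 f g = f ![g 1, g 2] + f ![g 0 * g 1, g 2] + f ![g 0, g 1 * g 2] + f ![g 0, g 1] := by
  have h0 : (fun i : Fin 2 => g i.succ) = ![g 1, g 2] := by ext i; fin_cases i <;> rfl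
  have h1 : Fin.contractNth (0 : Fin 3) (· * ·) g = ![g 0 * g 1, g 2] := by
    ext i; fin_cases i <;> rfl
  have h2 : Fin.contractNth (1 : Fin 3) (· * ·) g = ![g 0, g 1 * g 2] := by
    ext i; fin_cases i <;> rfl
  have h3 : Fin.contractNth (2 : Fin 3) (· * ·) g = ![g 0, g 1] := by
    ext i; fin_cases i <;> rfl
  have e : (-1 : ZMod 2) = 1 := by decide
  change f (fun i : Fin 2 => g i.succ) + ∑ j : Fin 3,
    (-1 : ZMod 2) ^ ((j : ℕ) + 1) * f (Fin.contractNth j (· * ·) g) = _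
  rw [Fin.sum_univ_three, h0, h1, h2, h3, e]
  ring

theorem cup_one_one_apply (f f' : Cochain G 1) (g : Fin 2 → G) :
    cup f f' g = f ![g 0] * f' ![g 1] := by
  have h0 : (fun i : Fin 1 => g (Fin.castAdd 1 i)) = ![g 0] := by ext i; fin_cases i; rfl
  have h1 : (fun i : Fin 1 => g (Fin.natAdd 1 i)) = ![g 1] := by ext i; fin_cases i; rfl
  change f (fun i : Fin 1 => g (Fin.castAdd 1 i)) * f' (fun i : Fin 1 => g (Fin.natAdd 1 i)) = _
  rw [h0, h1]

/-! ### Triple Massey products -/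

/-- A defining system for the triple Massey product of `α₁, α₂, α₃ ∈ H¹(G, ℤ/2)`: cochains `aᵢⱼ`
in `𝒞¹` for `1 ≤ i < j ≤ 4`, `(i, j) ≠ (1, 4)`, with `δ aᵢⱼ = ∑_{i < k < j} aᵢₖ ∪ aₖⱼ`, such that
`a₁₂, a₂₃, a₃₄` represent `α₁, α₂, α₃`. -/
structure DefiningSystem (α₁ α₂ α₃ : H G 1) where
  a12 : cocycles G 1
  a23 : cocycles G 1
  a34 : cocycles G 1
  a13 : Cochain G 1
  a24 : Cochain G 1
  class_a12 : classOf a12 = α₁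
  class_a23 : classOf a23 = α₂
  class_a34 : classOf a34 = α₃
  d_a13 : d G 1 a13 = cup a12.1 a23.1
  d_a24 : d G 1 a24 = cup a23.1 a34.1

theorem DefiningSystem.value_mem {α₁ α₂ α₃ : H G 1} (D : DefiningSystem α₁ α₂ α₃) :
    (cup D.a12.1 D.a24 + cup D.a13 D.a34.1 : Cochain G 2) ∈ cocycles G 2 := by
  have cocyc : ∀ (z : cocycles G 1) (x y : G), z.1 ![x * y] = z.1 ![x] + z.1 ![y] := by
    intro z x y
    have h := DFunLike.congr_fun (LinearMap.mem_ker.1 z.2) ![x, y]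
    rw [d_one_apply] at h
    exact (CharTwo.add_eq_zero.1 h).symm
  have h13 : ∀ x y : G, D.a13 ![x * y] = D.a13 ![x] + D.a13 ![y] + D.a12.1 ![x] * D.a23.1 ![y] := by
    intro x y
    have h := DFunLike.congr_fun D.d_a13 ![x, y]
    rw [d_one_apply, cup_one_one_apply] at h
    simp only [Matrix.cons_val_zero, Matrix.cons_val_one] at h
    rw [← h]
    linear_combination (- D.a13 ![x] - D.a13 ![y]) * (CharTwo.two_eq_zero (R := ZMod 2))
  have h24 : ∀ x y : G, D.a24 ![x * y] = D.a24 ![x] + D.a24 ![y] + D.a23.1 ![x] * D.a34.1 ![y] := by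
    intro x y
    have h := DFunLike.congr_fun D.d_a24 ![x, y]
    rw [d_one_apply, cup_one_one_apply] at h
    simp only [Matrix.cons_val_zero, Matrix.cons_val_one] at h
    rw [← h]
    linear_combination (- D.a24 ![x] - D.a24 ![y]) * (CharTwo.two_eq_zero (R := ZMod 2))
  refine LinearMap.mem_ker.2 (ContinuousMap.ext fun g => ?_)
  rw [d_two_apply]
  simp only [ContinuousMap.add_apply, cup_one_one_apply, Matrix.cons_val_zero, Matrix.cons_val_one,
    cocyc, h13, h24, ContinuousMap.zero_apply]
  generalize D.a12.1 ![g 0] = p0, D.a12.1 ![g 1] = p1, D.a24 ![g 1] = q1, D.a24 ![g 2] = q2,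
    D.a13 ![g 0] = r0, D.a13 ![g 1] = r1, D.a34.1 ![g 1] = s1, D.a34.1 ![g 2] = s2,
    D.a23.1 ![g 1] = t1
  linear_combination (p0 * t1 * s2 + p1 * q2 + p0 * q1 + p0 * q2 + r0 * s1 + r0 * s2 + r1 * s2) *
    (CharTwo.two_eq_zero (R := ZMod 2))

/-- The class `∑_{k=2}^{3} a₁ₖ ∪ aₖ₄` in `H²(G, ℤ/2)` attached to a defining system. -/
def DefiningSystem.value {α₁ α₂ α₃ : H G 1} (D : DefiningSystem α₁ α₂ α₃) : H G 2 :=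
  classOf ⟨cup D.a12.1 D.a24 + cup D.a13 D.a34.1, D.value_mem⟩

/-- The triple Massey product of `α₁, α₂, α₃` is defined if there is a defining system. -/
def MasseyDefined (α₁ α₂ α₃ : H G 1) : Prop := Nonempty (DefiningSystem α₁ α₂ α₃)

/-- The triple Massey product `⟨α₁, α₂, α₃⟩ ⊆ H²(G, ℤ/2)`. -/
def massey (α₁ α₂ α₃ : H G 1) : Set (H G 2) :=
  Set.range (DefiningSystem.value : DefiningSystem α₁ α₂ α₃ → H G 2)

end

end ContCochain

/-! ### The Kummer map -/

namespace Kummer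

section

variable {F : Type*} [Field F] (Fs : Type*) [Field Fs] [Algebra F Fs]

theorem exists_sqrt [IsSepClosure F Fs] (hF : ringChar F ≠ 2) (a : Fˣ) :
    ∃ r : Fs, r ^ 2 = algebraMap F Fs a := by
  have : IsSepClosed Fs := IsSepClosure.sep_closed F
  have h2 : (2 : F) ≠ 0 := Ring.two_ne_zero hF
  have : NeZero ((2 : ℕ) : Fs) :=
    ⟨by simpa only [map_ofNat, Nat.cast_ofNat] using (map_ne_zero (algebraMap F Fs)).2 h2⟩
  exact IsSepClosed.exists_pow_nat_eq _ 2

/-- The identification of `μ₂ = {1, -1}` with `ℤ/2`, on elements of a field. -/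
noncomputable def sign (z : Fs) : ZMod 2 := open Classical in if z = 1 then 0 else 1

variable {Fs}

/-- For `r` with `r² = a`, the continuous function `g ↦ g(r) / r ∈ μ₂ = ℤ/2` on the Galois
group. -/
noncomputable def cochain [IsSepClosure F Fs] (a : Fˣ) (r : Fs)
    (hr : r ^ 2 = algebraMap F Fs a) : ContCochain.Cochain (Fs ≃ₐ[F] Fs) 1 where
  toFun g := sign Fs (g 0 r / r)
  continuous_toFun := by
    have hr0 : r ≠ 0 := by
      rintro rfl
      exact (map_ne_zero (algebraMap F Fs)).2 a.ne_zero (by simpa using hr.symm)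
    have hsep : Algebra.IsSeparable F Fs := IsSepClosure.separable
    have hopen : IsOpen (MulAction.stabilizer (Fs ≃ₐ[F] Fs) r : Set (Fs ≃ₐ[F] Fs)) :=
      stabilizer_isOpen_of_isIntegral r
    have hclosed := Subgroup.isClosed_of_isOpen _ hopen
    have key : Continuous fun g : Fs ≃ₐ[F] Fs => sign Fs (g r / r) := by
      have hmem : ∀ g : Fs ≃ₐ[F] Fs,
          g ∈ (MulAction.stabilizer (Fs ≃ₐ[F] Fs) r : Set (Fs ≃ₐ[F] Fs)) ↔ g r / r = 1 := by
        intro g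
        rw [div_eq_one_iff_eq hr0]
        rfl
      refine continuous_discrete_rng.2 fun b => ?_
      by_cases hb : b = 0
      · convert hopen using 1
        ext g
        rw [hmem, Set.mem_preimage, Set.mem_singleton_iff, hb, sign]
        split_ifs with h <;> simp [h]
      · have hb1 : b = 1 := by revert b; decide
        convert hclosed.isOpen_compl using 1
        ext g
        rw [Set.mem_compl_iff, hmem, Set.mem_preimage, Set.mem_singleton_iff, hb1, sign]
        split_ifs with h <;> simp [h]
    exact key.comp (continuous_apply 0)

theorem cochain_mem [IsSepClosure F Fs] (hF : ringChar F ≠ 2) (a : Fˣ) (r : Fs)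
    (hr : r ^ 2 = algebraMap F Fs a) :
    cochain a r hr ∈ ContCochain.cocycles (Fs ≃ₐ[F] Fs) 1 := by
  have hr0 : r ≠ 0 := by
    rintro rfl
    exact (map_ne_zero (algebraMap F Fs)).2 a.ne_zero (by simpa using hr.symm)
  have h2 : (2 : Fs) ≠ 0 := by
    simpa only [map_ofNat] using (map_ne_zero (algebraMap F Fs)).2 (Ring.two_ne_zero hF)
  have hne : (-1 : Fs) ≠ 1 := fun h => h2 (by linear_combination -h)
  have pm : ∀ g : Fs ≃ₐ[F] Fs, g r = r ∨ g r = -r := fun g =>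
    sq_eq_sq_iff_eq_or_eq_neg.1 (by rw [← map_pow, hr, AlgEquiv.commutes])
  refine LinearMap.mem_ker.2 (ContinuousMap.ext fun g => ?_)
  rw [ContCochain.d_one_apply]
  change sign Fs (g 0 r / r) + sign Fs (g 1 r / r) + sign Fs (g 0 (g 1 r) / r) = 0
  rcases pm (g 0) with h | h <;> rcases pm (g 1) with h' | h' <;>
    simp [h, h', sign, hr0, hne] <;> decide

variable (Fs)

/-- The Kummer map `κ : Fˣ → H¹(Gal(Fˢ/F), ℤ/2)`: the connecting map of
`1 → μ₂ → 𝔾ₘ → 𝔾ₘ → 1`, which sends `a` to the class of `g ↦ g(√a)/√a`. -/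
noncomputable def kappa [IsSepClosure F Fs] (hF : ringChar F ≠ 2) (a : Fˣ) :
    ContCochain.H (Fs ≃ₐ[F] Fs) 1 :=
  ContCochain.classOf
    ⟨cochain a (exists_sqrt Fs hF a).choose (exists_sqrt Fs hF a).choose_spec,
      cochain_mem hF a _ _⟩

end

end Kummer

/-! ### The variety `X(a, b, c)` -/

namespace SplittingVariety

universe u

variable {F : Type u} [Field F]

/-- The polynomial
`(y₁² - a y₂² + c y₃² - a c y₄²)² - c (2 y₁ y₃ - 2 a y₂ y₄)²`,
the norm of `y₁ + y₂ √a + y₃ √c + y₄ √a √c`. -/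
def normPoly {A : Type*} [CommRing A] (a c y₁ y₂ y₃ y₄ : A) : A :=
  (y₁ ^ 2 - a * y₂ ^ 2 + c * y₃ ^ 2 - a * c * y₄ ^ 2) ^ 2
    - c * (2 * y₁ * y₃ - 2 * a * y₂ * y₄) ^ 2

variable (F) in
/-- The coordinate ring `F[x, x⁻¹, y₁, y₂, y₃, y₄]` of `𝔾ₘ × 𝔸⁴`; the variable with index `0` is
`x`, the one with index `i = 1, 2, 3, 4` is `yᵢ`. -/
abbrev AmbientRing : Type u :=
  Localization.Away (MvPolynomial.X 0 : MvPolynomial (Fin 5) F)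

variable (F) in
/-- The coordinate functions on `𝔾ₘ × 𝔸⁴`. -/
noncomputable def coord (i : Fin 5) : AmbientRing F :=
  algebraMap (MvPolynomial (Fin 5) F) (AmbientRing F) (MvPolynomial.X i)

/-- The function `b x² - N(y₁, y₂, y₃, y₄)` on `𝔾ₘ × 𝔸⁴`. -/
noncomputable def equation (a b c : Fˣ) : AmbientRing F :=
  algebraMap F (AmbientRing F) b * coord F 0 ^ 2 -
    normPoly (algebraMap F (AmbientRing F) a) (algebraMap F (AmbientRing F) c)
      (coord F 1) (coord F 2) (coord F 3) (coord F 4)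

/-- The coordinate ring `F[x, x⁻¹, y₁, y₂, y₃, y₄] / ⟨b x² - N(y₁, y₂, y₃, y₄)⟩`. -/
abbrev CoordRing (a b c : Fˣ) : Type u := AmbientRing F ⧸ Ideal.span {equation a b c}

/-- The affine scheme `X(a, b, c)`. -/
noncomputable abbrev X (a b c : Fˣ) : Scheme.{u} := Spec (.of (CoordRing a b c))

/-- The structure morphism `X(a, b, c) ⟶ Spec F`. -/
noncomputable def structureMap (a b c : Fˣ) : X a b c ⟶ Spec (.of F) :=
  Spec.map (CommRingCat.ofHom (algebraMap F (CoordRing a b c)))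

/-- The `F`-points of `X(a, b, c)`: the sections of the structure morphism. -/
def Point (a b c : Fˣ) : Type u :=
  {s : Spec (.of F) ⟶ X a b c // s ≫ structureMap a b c = 𝟙 _}

end SplittingVariety

/-! Write `E = F[√a, √c]` for the étale algebra of degree 4. An `F`-point of `X(a,b,c)` is an
element of `E` whose norm is `b` up to a nonzero square. Kummer theory and Shapiro's lemma identify
`Eˣ/Eˣ²` with `H¹` of the module of functions `(ℤ/2)² → ℤ/2`, on which Galois acts by translation
through `(κ(a), κ(c))`. The norm to `Fˣ/Fˣ²` becomes summation of values. So a point exists iff some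
`1`-cocycle in this module has sum `κ(b)`.

On the other side, `0` lies in the Massey product iff `κ(a), κ(b), κ(c)` are the superdiagonal
entries of a homomorphism to the unipotent group `U₄(ℤ/2)`. This group is an extension of `(ℤ/2)²`
(entries 12 and 34) by the upper right `2 × 2` block, which is the same module of functions, with
entry 23 as the sum. Such homomorphisms are therefore the same cocycles:
`zero_mem_massey_iff_exists_cocycle`.

The passage between cocycles and points is explicit. Signs of square roots of the four conjugates
give a cocycle (`exists_cocycle_of_solution`); a form of Hilbert 90 recovers the square roots
(`exists_semiinvariant`, `exists_solution_of_cocycle`). -/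

theorem ZMod.sum_univ_two_prod {A : Type*} [AddCommMonoid A] (f : ZMod 2 × ZMod 2 → A) :
    ∑ k, f k = f (0, 0) + f (0, 1) + (f (1, 0) + f (1, 1)) := by
  rw [Fintype.sum_prod_type]
  exact (Fin.sum_univ_two (fun i : Fin 2 => ∑ j : Fin 2, f (i, j))).trans
    (by rw [Fin.sum_univ_two, Fin.sum_univ_two]; rfl)

theorem ZMod.prod_univ_two_prod {A : Type*} [CommMonoid A] (f : ZMod 2 × ZMod 2 → A) :
    ∏ k, f k = f (0, 0) * f (0, 1) * (f (1, 0) * f (1, 1)) := by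
  rw [Fintype.prod_prod_type]
  exact (Fin.prod_univ_two (fun i : Fin 2 => ∏ j : Fin 2, f (i, j))).trans
    (by rw [Fin.prod_univ_two, Fin.prod_univ_two]; rfl)

/-- Every function on `(ℤ/2)²` is a polynomial of degree at most one in each variable. -/
theorem ZMod.eq_polynomial_of_two_prod (f : ZMod 2 × ZMod 2 → ZMod 2) (x y : ZMod 2) :
    f (x, y) = f (0, 0) + (f (1, 0) + f (0, 0)) * x + (f (0, 1) + f (0, 0)) * y +
      (∑ k, f k) * (x * y) := by
  rw [ZMod.sum_univ_two_prod]
  generalize h00 : f (0, 0) = a, h01 : f (0, 1) = b, h10 : f (1, 0) = c, h11 : f (1, 1) = d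
  have hx : x = 0 ∨ x = 1 := by revert x; decide
  have hy : y = 0 ∨ y = 1 := by revert y; decide
  rcases hx with rfl | rfl <;> rcases hy with rfl | rfl <;>
    simp only [h00, h01, h10, h11] <;> clear h00 h01 h10 h11 <;> revert a b c d <;> decide

/-! ### Massey products as cocycles valued in functions on `(ℤ/2)²` -/

namespace ContCochain

variable {G : Type*} [Group G] [TopologicalSpace G] [IsTopologicalGroup G]

theorem d_zero_eq_zero : d G 0 = 0 := by
  ext f g
  have h : Fin.contractNth (0 : Fin 1) (· * ·) g = fun i => g i.succ := by
    ext i; exact i.elim0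
  change f (fun i : Fin 0 => g i.succ) + ∑ j : Fin 1,
    (-1 : ZMod 2) ^ ((j : ℕ) + 1) * f (Fin.contractNth j (· * ·) g) = 0
  rw [Fin.sum_univ_one, h]
  simpa using CharTwo.add_self_eq_zero _

/-- The action is trivial, so there are no nonzero `1`-coboundaries. Hence the cocycles in a
defining system are forced. -/
theorem classOf_one_injective : Function.Injective (classOf : cocycles G 1 → H G 1) := by
  intro z w h
  have h' := (Submodule.Quotient.eq _).1 h
  obtain ⟨f, hf⟩ : ((z - w : cocycles G 1) : Cochain G 1) ∈ LinearMap.range (d G 0) := h'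
  rw [d_zero_eq_zero] at hf
  exact Subtype.ext (sub_eq_zero.1 hf.symm)

theorem classOf_two_eq_zero_iff (z : cocycles G 2) :
    classOf z = 0 ↔ ∃ f : Cochain G 1, d G 1 f = z.1 := by
  rw [classOf, Submodule.Quotient.mk_eq_zero]
  rfl

theorem zero_mem_massey_iff (χ₁ χ₂ χ₃ : cocycles G 1) :
    0 ∈ massey (classOf χ₁) (classOf χ₂) (classOf χ₃) ↔
      ∃ a13 a24 a14 : Cochain G 1, d G 1 a13 = cup χ₁.1 χ₂.1 ∧ d G 1 a24 = cup χ₂.1 χ₃.1 ∧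
        d G 1 a14 = cup χ₁.1 a24 + cup a13 χ₃.1 := by
  constructor
  · rintro ⟨D, hD⟩
    obtain ⟨a14, h⟩ := (classOf_two_eq_zero_iff _).1 hD
    have h12 := classOf_one_injective D.class_a12
    have h12' := congrArg Subtype.val h12
    have h23 := classOf_one_injective D.class_a23
    have h34 := classOf_one_injective D.class_a34
    have h34' := congrArg Subtype.val h34
    refine ⟨D.a13, D.a24, a14, ?_, ?_, ?_⟩
    · rw [D.d_a13, h12, h23]
    · rw [D.d_a24, h23, h34]
    · rw [← h12', ← h34']
      exact h
  · rintro ⟨a13, a24, a14, h13, h24, h14⟩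
    exact ⟨⟨χ₁, χ₂, χ₃, a13, a24, rfl, rfl, rfl, h13, h24⟩,
      (classOf_two_eq_zero_iff _).2 ⟨a14, h14⟩⟩

theorem d_one_eq_iff (f : Cochain G 1) (f' : Cochain G 2) :
    d G 1 f = f' ↔ ∀ g h : G, f ![g * h] = f ![g] + f ![h] + f' ![g, h] := by
  have key : ∀ x y z w : ZMod 2, x + y + z = w ↔ z = x + y + w := by decide
  constructor
  · rintro rfl g h
    rw [← key, d_one_apply]
    rfl
  · intro H
    ext g
    rw [d_one_apply, key, H]
    congr 2
    ext i; fin_cases i <;> rfl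

theorem cocycles_one_apply_mul (z : cocycles G 1) (g h : G) :
    z.1 ![g * h] = z.1 ![g] + z.1 ![h] := by
  simpa using (d_one_eq_iff z.1 0).1 (LinearMap.mem_ker.1 z.2) g h

/-- The group of unipotent upper triangular `4 × 4`-matrices over `ℤ/2` is the wreath product of
`ℤ/2` with `(ℤ/2)²`: the vanishing of a triple Massey product of characters is expressed by a
`1`-cocycle with values in the functions on `(ℤ/2)²`. -/
theorem zero_mem_massey_iff_exists_cocycle (χ₁ χ₂ χ₃ : cocycles G 1) :
    0 ∈ massey (classOf χ₁) (classOf χ₂) (classOf χ₃) ↔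
      ∃ φ : G → ZMod 2 × ZMod 2 → ZMod 2, (∀ k, Continuous fun g => φ g k) ∧
        (∀ g h k, φ (g * h) k = φ g k + φ h (k + (χ₁.1 ![g], χ₃.1 ![g]))) ∧
        ∀ g, ∑ k, φ g k = χ₂.1 ![g] := by
  have m₁ := cocycles_one_apply_mul χ₁
  have m₂ := cocycles_one_apply_mul χ₂
  have m₃ := cocycles_one_apply_mul χ₃
  have cont : ∀ f : Cochain G 1, Continuous fun g : G => f ![g] := fun f =>
    f.continuous.comp (continuous_pi fun i => by fin_cases i; exact continuous_id)
  rw [zero_mem_massey_iff]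
  simp only [d_one_eq_iff, cup_one_one_apply, ContinuousMap.add_apply, Matrix.cons_val_zero,
    Matrix.cons_val_one]
  constructor
  · rintro ⟨s, u, v, hs, hu, hv⟩
    -- With diagonal blocks `P, R` and upper right block `Q = (s, v; χ₂, u)` of the unipotent matrix
    -- of `g`, this is `(1, x) Q R⁻¹ (y, 1)ᵀ` at `k = (x, y)`. Multiplying block matrices gives the
    -- cocycle relation.
    refine ⟨fun g k => v ![g] + χ₃.1 ![g] * s ![g] + (u ![g] + χ₃.1 ![g] * χ₂.1 ![g]) * k.1 +
      s ![g] * k.2 + χ₂.1 ![g] * (k.1 * k.2), fun k => ?_, fun g h k => ?_, fun g => ?_⟩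
    · have := cont s
      have := cont u
      have := cont v
      have := cont χ₂.1
      have := cont χ₃.1
      fun_prop
    · simp only [Prod.fst_add, Prod.snd_add, m₂, m₃, hs, hu, hv]
      grind
    · rw [ZMod.sum_univ_two_prod]
      grind
  · rintro ⟨φ, hc, hφ, hsum⟩
    have poly : ∀ (g : G) (x y : ZMod 2), φ g (x, y) = φ g (0, 0) +
        (φ g (1, 0) + φ g (0, 0)) * x + (φ g (0, 1) + φ g (0, 0)) * y +
          χ₂.1 ![g] * (x * y) := fun g x y => by
      rw [← hsum]; exact ZMod.eq_polynomial_of_two_prod (φ g) x y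
    have e : ∀ g h x y, φ (g * h) (x, y) = φ g (x, y) + (φ h (0, 0) +
        (φ h (1, 0) + φ h (0, 0)) * (x + χ₁.1 ![g]) + (φ h (0, 1) + φ h (0, 0)) *
          (y + χ₃.1 ![g]) + χ₂.1 ![h] * ((x + χ₁.1 ![g]) * (y + χ₃.1 ![g]))) :=
      fun g h x y => by rw [hφ, ← poly]; rfl
    have ev : Continuous fun g : Fin 1 → G => g 0 := continuous_apply 0
    have c00 := (hc (0, 0)).comp ev
    have c01 := (hc (0, 1)).comp ev
    have c10 := (hc (1, 0)).comp ev
    have c2 := (cont χ₂.1).comp ev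
    have c3 := (cont χ₃.1).comp ev
    -- The coefficients of the polynomial `φ g` are the entries of `Q R⁻¹`; multiplying by `R` on
    -- the right recovers `Q`.
    refine ⟨⟨fun g => φ (g 0) (0, 1) + φ (g 0) (0, 0), c01.add c00⟩,
      ⟨fun g => φ (g 0) (1, 0) + φ (g 0) (0, 0) + χ₃.1 ![g 0] * χ₂.1 ![g 0],
        (c10.add c00).add (c3.mul c2)⟩,
      ⟨fun g => φ (g 0) (0, 0) + χ₃.1 ![g 0] * (φ (g 0) (0, 1) + φ (g 0) (0, 0)),
        c00.add (c3.mul (c01.add c00))⟩, fun g h => ?_, fun g h => ?_, fun g h => ?_⟩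
    all_goals
      simp only [ContinuousMap.coe_mk, Matrix.cons_val_zero, e, m₂, m₃]
      grind

end ContCochain

/-! ### Signs in a field and Hilbert 90 -/

namespace Kummer

section Sign

variable {K : Type*} [Field K]

variable (K) in
/-- The inclusion of `ℤ/2` into a field as `{1, -1}`. -/
def unitSign (t : ZMod 2) : K := if t = 0 then 1 else -1

@[simp] theorem unitSign_zero : unitSign K 0 = 1 := rfl

@[simp] theorem unitSign_one : unitSign K 1 = -1 := rfl

theorem zmod_two_eq (t : ZMod 2) : t = 0 ∨ t = 1 := by revert t; decide

theorem unitSign_add (s t : ZMod 2) : unitSign K (s + t) = unitSign K s * unitSign K t := by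
  have h : (1 + 1 : ZMod 2) = 0 := by decide
  rcases zmod_two_eq s with rfl | rfl <;> rcases zmod_two_eq t with rfl | rfl <;> simp [h]

theorem unitSign_mul_self (t : ZMod 2) : unitSign K t * unitSign K t = 1 := by
  rcases zmod_two_eq t with rfl | rfl <;> simp

theorem unitSign_ne_zero (t : ZMod 2) : unitSign K t ≠ 0 := by
  rcases zmod_two_eq t with rfl | rfl <;> simp

theorem map_unitSign {L S : Type*} [Field L] [FunLike S K L] [RingHomClass S K L] (f : S)
    (t : ZMod 2) : f (unitSign K t) = unitSign L t := by
  rcases zmod_two_eq t with rfl | rfl <;> simp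

theorem unitSign_injective (h2 : (2 : K) ≠ 0) : Function.Injective (unitSign K) := by
  have hne : (-1 : K) ≠ 1 := fun h => h2 (by linear_combination -h)
  intro s t
  rcases zmod_two_eq s with rfl | rfl <;> rcases zmod_two_eq t with rfl | rfl <;>
    simp [hne, hne.symm]

theorem unitSign_sign {z : K} (hz : z ^ 2 = 1) : unitSign K (sign K z) = z := by
  rcases (sq_eq_sq_iff_eq_or_eq_neg (a := z) (b := 1)).1 (by rw [hz, one_pow]) with rfl | rfl
  · simp [sign]
  · by_cases h : (-1 : K) = 1 <;> simp [sign, h]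

end Sign

variable {F K : Type*} [Field F] [Field K] [Algebra F K]

theorem eventually_apply_eq [Algebra.IsIntegral F K] (w : K) (g : K ≃ₐ[F] K) :
    ∀ᶠ h in nhds g, h w = g w := by
  have hopen := stabilizer_isOpen_of_isIntegral (K := F) w
  have h1 : ∀ᶠ u in nhds (1 : K ≃ₐ[F] K), u w = w :=
    Filter.mem_of_superset (hopen.mem_nhds (one_mem _)) fun u hu => hu
  have h2 : Filter.Tendsto (fun h => g⁻¹ * h) (nhds g) (nhds 1) := by
    have : Continuous fun h : K ≃ₐ[F] K => g⁻¹ * h := by fun_prop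
    simpa using this.tendsto g
  filter_upwards [h2.eventually h1] with h hh
  have := congrArg g hh
  rwa [← AlgEquiv.mul_apply, mul_inv_cancel_left] at this

/-- A version of Hilbert's theorem 90 for signed permutation representations. -/
theorem exists_semiinvariant_of_fixingSubgroup [IsSepClosure F K] {M : Type*} [AddCommGroup M]
    (A : (K ≃ₐ[F] K) → M) (hA : ∀ g h, A (g * h) = A g + A h)
    (φ : (K ≃ₐ[F] K) → M → ZMod 2) (hφ : ∀ g h k, φ (g * h) k = φ g k + φ h (k + A g))
    (L : IntermediateField F K) [FiniteDimensional F L]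
    (hLA : ∀ u ∈ L.fixingSubgroup, A u = 0) (hLφ : ∀ u ∈ L.fixingSubgroup, ∀ k, φ u k = 0) :
    ∃ r : M → K, (∀ k, r k ≠ 0) ∧ ∀ g k, g (r (k + A g)) = unitSign K (φ g k) * r k := by
  classical
  have : IsSepClosed K := IsSepClosure.sep_closed F
  have : Algebra.IsSeparable F K := IsSepClosure.separable
  have hA1 : A 1 = 0 := by simpa using hA 1 1
  have hAinv : ∀ g, A g⁻¹ = - A g := fun g => by
    rw [eq_neg_iff_add_eq_zero, ← hA, inv_mul_cancel, hA1]
  -- Sums run over the embeddings of `L`, each lifted to an automorphism, so `L` need not be normal.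
  -- By `hu`, `A` and `φ` do not depend on the lift.
  have hlift : ∀ σ : L →ₐ[F] K, ∃ g : K ≃ₐ[F] K, ∀ x : L, g x = σ x := fun σ => by
    obtain ⟨τ, hτ⟩ := IsSepClosed.surjective_domRestrict_of_isSeparable (K := F) (L := L)
      (E := K) (M := K) σ
    exact ⟨AlgEquiv.ofBijective τ (Algebra.IsAlgebraic.algHom_bijective τ),
      fun x => DFunLike.congr_fun hτ x⟩
  choose l hl using hlift
  have hu : ∀ g h : K ≃ₐ[F] K, (∀ x : L, g x = h x) → A g = A h ∧ ∀ k, φ g k = φ h k := by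
    intro g h hgh
    have hmem : h⁻¹ * g ∈ L.fixingSubgroup := by
      rw [IntermediateField.mem_fixingSubgroup_iff]
      intro x hx
      rw [AlgEquiv.mul_apply, hgh ⟨x, hx⟩, ← AlgEquiv.mul_apply, inv_mul_cancel,
        AlgEquiv.one_apply]
    have hg : g = h * (h⁻¹ * g) := by group
    exact ⟨by rw [hg, hA, hLA _ hmem, add_zero], fun k => by rw [hg, hφ, hLφ _ hmem, add_zero]⟩
  -- Independence of embeddings: the coefficient at the inclusion of `L` is a sign, hence nonzero.
  have hsingle : ∀ k : M, ∃ w : L,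
      ∑ σ : L →ₐ[F] K, (if A (l σ) = 0 then unitSign K (φ (l σ) k) else 0) * σ w ≠ 0 := by
    intro k
    by_contra! hcon
    have hind := Fintype.linearIndependent_iff.1 (linearIndependent_toLinearMap F L K)
      (fun σ => if A (l σ) = 0 then unitSign K (φ (l σ) k) else 0)
      (LinearMap.ext fun w => by simpa [LinearMap.sum_apply, ← smul_eq_mul, ← ite_smul] using! hcon w) L.val
    have h0 : A (l L.val) = 0 := by rw [(hu _ 1 (hl L.val)).1, hA1]
    simp only [h0, if_true] at hind
    exact unitSign_ne_zero _ hind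
  choose w hw using hsingle
  let S : Setoid M :=
    { r := fun m n => ∃ g, n = m + A g
      iseqv := ⟨fun m => ⟨1, by rw [hA1, add_zero]⟩,
        fun {m n} ⟨g, hg⟩ => ⟨g⁻¹, by rw [hAinv, hg, add_neg_cancel_right]⟩,
        fun {m n p} ⟨g, hg⟩ ⟨h, hh⟩ => ⟨g * h, by rw [hA, hh, hg, add_assoc]⟩⟩ }
  let rep : M → M := fun m => (Quotient.mk S m).out
  have hrep : ∀ m g, rep (m + A g) = rep m := fun m g =>
    congrArg Quotient.out (Quotient.sound (s := S) ⟨g, rfl⟩ :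
      Quotient.mk S m = Quotient.mk S (m + A g)).symm
  have hrep' : ∀ m, ∃ g, m = rep m + A g := fun m => Quotient.mk_out (s := S) m
  -- A seed supported on one representative of each orbit of translation by the values of `A`.
  let z : M → L := fun m => if rep m = m then w m else 0
  -- The Poincaré series of the seed; reindexing by `σ ↦ g ∘ σ` gives semi-invariance. At a
  -- representative only the `σ` with `A = 0` survive, leaving the sum of `hsingle`. Semi-invariance
  -- carries nonvanishing along the orbit.
  let r : M → K := fun k => ∑ σ : L →ₐ[F] K, unitSign K (φ (l σ) k) * σ (z (k + A (l σ)))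
  have hr : ∀ g k, g (r (k + A g)) = unitSign K (φ g k) * r k := by
    intro g k
    simp only [r, map_sum, Finset.mul_sum, map_mul, map_unitSign]
    refine Fintype.sum_equiv (AlgEquiv.arrowCongr (AlgEquiv.refl (R := F) (A₁ := L)) g) _ _
      fun σ => ?_
    obtain ⟨e1, e2⟩ := hu (l ((AlgEquiv.refl (R := F) (A₁ := L)).arrowCongr g σ)) (g * l σ)
      fun x => by rw [hl, AlgEquiv.mul_apply, hl]; rfl
    rw [e1, e2, hA, hφ, unitSign_add, ← mul_assoc, ← mul_assoc, unitSign_mul_self, one_mul,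
      add_assoc]
    rfl
  have hrne : ∀ k, rep k = k → r k ≠ 0 := by
    intro k hk
    convert hw k using 1
    refine Finset.sum_congr rfl fun σ _ => ?_
    by_cases h : A (l σ) = 0
    · simp [h, z, hk]
    · simp [h, z, hrep, hk]
  refine ⟨r, fun k h0 => ?_, hr⟩
  obtain ⟨g, hg⟩ := hrep' k
  have h1 := hr g (rep k)
  rw [← hg, h0, map_zero] at h1
  refine (mul_ne_zero (unitSign_ne_zero _) (hrne (rep k) ?_)) h1.symm
  exact (hrep (rep k) g).symm.trans (congrArg rep hg.symm)

/-- By continuity and finiteness of `M`, `A` and `φ` vanish on the fixing subgroup of some finite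
extension. -/
theorem exists_semiinvariant [IsSepClosure F K] {M : Type*} [AddCommGroup M] [Finite M]
    (A : (K ≃ₐ[F] K) → M) (hA : ∀ g h, A (g * h) = A g + A h) (hAc : ∀ᶠ u in nhds 1, A u = 0)
    (φ : (K ≃ₐ[F] K) → M → ZMod 2) (hφ : ∀ g h k, φ (g * h) k = φ g k + φ h (k + A g))
    (hφc : ∀ k, Continuous fun g => φ g k) :
    ∃ r : M → K, (∀ k, r k ≠ 0) ∧ ∀ g k, g (r (k + A g)) = unitSign K (φ g k) * r k := by
  have hA1 : A 1 = 0 := by simpa using hA 1 1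
  have hφ1 : ∀ k, φ 1 k = 0 := fun k => by simpa [hA1] using hφ 1 1 k
  have hφ0 : ∀ᶠ u in nhds (1 : K ≃ₐ[F] K), ∀ k, φ u k = 0 := by
    rw [Filter.eventually_all]
    intro k
    have h := (hφc k).tendsto 1
    rw [hφ1] at h
    exact h.eventually ((isOpen_discrete {(0 : ZMod 2)}).mem_nhds rfl)
  obtain ⟨L, hL, hsub⟩ := (krullTopology_mem_nhds_one_iff F K _).1 (hAc.and hφ0)
  exact exists_semiinvariant_of_fixingSubgroup A hA φ hφ L (fun u hu => (hsub hu).1)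
    fun u hu => (hsub hu).2

end Kummer

/-! ### Conjugates and the norm form -/

namespace SplittingVariety

open Kummer

section Conjugates

variable {K : Type*} [Field K]

/-- The conjugates of `y₁ + y₂ α + y₃ γ + y₄ α γ` under the sign changes of `α` and `γ`. -/
def conjugate (α γ y₁ y₂ y₃ y₄ : K) (k : ZMod 2 × ZMod 2) : K :=
  y₁ + unitSign K k.1 * y₂ * α + unitSign K k.2 * y₃ * γ +
    unitSign K k.1 * unitSign K k.2 * y₄ * α * γ

theorem prod_conjugate (α γ y₁ y₂ y₃ y₄ : K) :
    ∏ k, conjugate α γ y₁ y₂ y₃ y₄ k = normPoly (α ^ 2) (γ ^ 2) y₁ y₂ y₃ y₄ := by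
  simp only [ZMod.prod_univ_two_prod, conjugate, normPoly, unitSign_zero, unitSign_one]
  ring

/-- Fourier inversion on `(ℤ/2)²`: any four values are the formal conjugates of one element, since
`4`, `α` and `γ` are invertible. -/
theorem exists_conjugate_eq (h2 : (2 : K) ≠ 0) {α γ : K} (hα : α ≠ 0) (hγ : γ ≠ 0)
    (y : ZMod 2 × ZMod 2 → K) (k : ZMod 2 × ZMod 2) :
    conjugate α γ ((∑ m, y m) / 4) ((∑ m, unitSign K m.1 * y m) / (4 * α))
      ((∑ m, unitSign K m.2 * y m) / (4 * γ))
      ((∑ m, unitSign K (m.1 + m.2) * y m) / (4 * (α * γ))) k = y k := by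
  have h4 : (4 : K) ≠ 0 := by
    have := mul_ne_zero h2 h2
    norm_num at this
    exact this
  obtain ⟨i, j⟩ := k
  rcases zmod_two_eq i with rfl | rfl <;> rcases zmod_two_eq j with rfl | rfl <;>
    simp only [conjugate, ZMod.sum_univ_two_prod, unitSign_add, unitSign_zero, unitSign_one] <;>
    field_simp <;> ring

theorem prod_unitSign (f : ZMod 2 × ZMod 2 → ZMod 2) :
    ∏ k, unitSign K (f k) = unitSign K (∑ k, f k) := by
  simp only [ZMod.prod_univ_two_prod, ZMod.sum_univ_two_prod, unitSign_add]

end Conjugates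

variable {F K : Type*} [Field F] [Field K] [Algebra F K]

theorem map_mul_of_apply_eq_unitSign_mul (h2 : (2 : K) ≠ 0) {δ : K} (hδ : δ ≠ 0)
    {D : (K ≃ₐ[F] K) → ZMod 2} (hD : ∀ g, g δ = unitSign K (D g) * δ) (g h : K ≃ₐ[F] K) :
    D (g * h) = D g + D h := by
  refine unitSign_injective h2 (mul_right_cancel₀ hδ ?_)
  rw [← hD, AlgEquiv.mul_apply, hD h, map_mul, map_unitSign, hD g, unitSign_add]
  ring

theorem map_conjugate (g : K ≃ₐ[F] K) {α γ : K} {s : ZMod 2 × ZMod 2}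
    (hα : g α = unitSign K s.1 * α) (hγ : g γ = unitSign K s.2 * γ) (y₁ y₂ y₃ y₄ : F)
    (k : ZMod 2 × ZMod 2) :
    g (conjugate α γ (algebraMap F K y₁) (algebraMap F K y₂) (algebraMap F K y₃)
      (algebraMap F K y₄) k) =
    conjugate α γ (algebraMap F K y₁) (algebraMap F K y₂) (algebraMap F K y₃)
      (algebraMap F K y₄) (k + s) := by
  simp only [conjugate, map_add, map_mul, AlgEquiv.commutes, map_unitSign, hα, hγ, Prod.fst_add,
    Prod.snd_add, unitSign_add]
  ring

theorem map_normPoly {A B : Type*} [CommRing A] [CommRing B] (f : A →+* B)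
    (a c y₁ y₂ y₃ y₄ : A) :
    f (normPoly a c y₁ y₂ y₃ y₄) = normPoly (f a) (f c) (f y₁) (f y₂) (f y₃) (f y₄) := by
  simp only [normPoly, map_sub, map_add, map_mul, map_pow, map_ofNat]

/-! ### Solutions of the norm equation and cocycles -/

section Cocycles

variable [IsSepClosure F K]

/-- Galois translates the indices of the conjugates `y k`, hence translates their square roots `r k`
up to sign. These signs are the cocycle, and their product is read off from `∏ r k = ± β x`. -/
theorem exists_cocycle_of_solution (h2 : (2 : F) ≠ 0) {a b c : F} {α β γ : K}
    (hα : α ^ 2 = algebraMap F K a) (hβ : β ^ 2 = algebraMap F K b)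
    (hγ : γ ^ 2 = algebraMap F K c) (hα0 : α ≠ 0) (hβ0 : β ≠ 0) (hγ0 : γ ≠ 0)
    {A B C : (K ≃ₐ[F] K) → ZMod 2} (hA : ∀ g, g α = unitSign K (A g) * α)
    (hB : ∀ g, g β = unitSign K (B g) * β) (hC : ∀ g, g γ = unitSign K (C g) * γ)
    {x y₁ y₂ y₃ y₄ : F} (hx : x ≠ 0) (h : b * x ^ 2 = normPoly a c y₁ y₂ y₃ y₄) :
    ∃ φ : (K ≃ₐ[F] K) → ZMod 2 × ZMod 2 → ZMod 2, (∀ k, Continuous fun g => φ g k) ∧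
      (∀ g h k, φ (g * h) k = φ g k + φ h (k + (A g, C g))) ∧ ∀ g, ∑ k, φ g k = B g := by
  have : IsSepClosed K := IsSepClosure.sep_closed F
  have : Algebra.IsSeparable F K := IsSepClosure.separable
  have h2K : (2 : K) ≠ 0 := by
    simpa only [map_ofNat] using (map_ne_zero (algebraMap F K)).2 h2
  have : NeZero ((2 : ℕ) : K) := ⟨by exact_mod_cast h2K⟩
  have inj := unitSign_injective h2K
  have char : ∀ m : ZMod 2 × ZMod 2, m + m = 0 := by decide
  let y := conjugate α γ (algebraMap F K y₁) (algebraMap F K y₂) (algebraMap F K y₃)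
    (algebraMap F K y₄)
  have hy : ∏ k, y k = (β * algebraMap F K x) ^ 2 := by
    rw [prod_conjugate, hα, hγ, ← map_normPoly, ← h, map_mul, map_pow, mul_pow, hβ]
  have hy0 : ∀ k, y k ≠ 0 := by
    have hne : ∏ k, y k ≠ 0 := by
      rw [hy]
      exact pow_ne_zero _ (mul_ne_zero hβ0 ((map_ne_zero _).2 hx))
    exact fun k => Finset.prod_ne_zero_iff.1 hne k (Finset.mem_univ k)
  choose r hr using fun k => IsSepClosed.exists_pow_nat_eq (y k) 2
  have hr0 : ∀ k, r k ≠ 0 := fun k h0 => hy0 k (by rw [← hr, h0, zero_pow two_ne_zero])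
  have hφ : ∀ (g : K ≃ₐ[F] K) k, unitSign K (sign K (g (r (k + (A g, C g))) / r k)) * r k =
      g (r (k + (A g, C g))) := by
    intro g k
    rw [unitSign_sign, div_mul_cancel₀ _ (hr0 k)]
    rw [div_pow, ← map_pow, hr, hr]
    rw [map_conjugate g (s := (A g, C g)) (hA g) (hC g), add_assoc, char, add_zero]
    exact div_self (hy0 k)
  have hA' := map_mul_of_apply_eq_unitSign_mul h2K hα0 hA
  have hC' := map_mul_of_apply_eq_unitSign_mul h2K hγ0 hC
  refine ⟨fun g k => sign K (g (r (k + (A g, C g))) / r k), fun k => ?_, fun g h k => ?_,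
    fun g => ?_⟩
  · refine ((IsLocallyConstant.iff_eventually_eq _).2 fun g => ?_).continuous
    -- The cocycle depends on `g` only through its action on `α`, `γ` and the four `r m`.
    have ev : ∀ᶠ u in nhds g, A u = A g ∧ C u = C g ∧ ∀ m, u (r m) = g (r m) := by
      filter_upwards [eventually_apply_eq α g, eventually_apply_eq γ g,
        Filter.eventually_all.2 fun m => eventually_apply_eq (r m) g] with u h1 h2 h3
      rw [hA, hA] at h1
      rw [hC, hC] at h2
      exact ⟨inj (mul_right_cancel₀ hα0 h1), inj (mul_right_cancel₀ hγ0 h2), h3⟩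
    filter_upwards [ev] with u hu
    rw [hu.1, hu.2.1, hu.2.2]
  · refine inj (mul_right_cancel₀ (hr0 k) ?_)
    rw [hφ, unitSign_add, mul_right_comm, hφ, AlgEquiv.mul_apply, hA', hC', ← Prod.mk_add_mk,
      ← add_assoc, ← hφ h, map_mul, map_unitSign, mul_comm]
  · have hprod : (∏ k, r k) ^ 2 = (β * algebraMap F K x) ^ 2 := by
      rw [← hy, ← Finset.prod_pow]
      exact Finset.prod_congr rfl fun k _ => hr k
    have hg : g (∏ k, r k) = unitSign K (B g) * ∏ k, r k := by
      rcases sq_eq_sq_iff_eq_or_eq_neg.1 hprod with e | e <;>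
        simp only [e, map_neg, map_mul, hB, AlgEquiv.commutes] <;> ring
    have hne : ∏ k, r k ≠ 0 := Finset.prod_ne_zero_iff.2 fun k _ => hr0 k
    refine inj (mul_right_cancel₀ hne ?_)
    rw [← hg, ← prod_unitSign, ← Finset.prod_mul_distrib, map_prod]
    simp only [hφ]
    exact Fintype.prod_equiv (Equiv.addRight (A g, C g)) _ _ fun k => rfl

/-- Squaring the semi-invariant `r` removes the signs, so Galois purely translates the indices of `r
k ^ 2`: these are the conjugates of an element with coordinates in `F`. The signs of `∏ r k` are
those of `β`, so `x = ∏ r k / β` descends too. -/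
theorem exists_solution_of_cocycle (h2 : (2 : F) ≠ 0) {a b c : F} {α β γ : K}
    (hα : α ^ 2 = algebraMap F K a) (hβ : β ^ 2 = algebraMap F K b)
    (hγ : γ ^ 2 = algebraMap F K c) (hα0 : α ≠ 0) (hβ0 : β ≠ 0) (hγ0 : γ ≠ 0)
    {A B C : (K ≃ₐ[F] K) → ZMod 2} (hA : ∀ g, g α = unitSign K (A g) * α)
    (hB : ∀ g, g β = unitSign K (B g) * β) (hC : ∀ g, g γ = unitSign K (C g) * γ)
    (φ : (K ≃ₐ[F] K) → ZMod 2 × ZMod 2 → ZMod 2) (hφc : ∀ k, Continuous fun g => φ g k)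
    (hφ : ∀ g h k, φ (g * h) k = φ g k + φ h (k + (A g, C g)))
    (hφs : ∀ g, ∑ k, φ g k = B g) :
    ∃ x y₁ y₂ y₃ y₄ : F, x ≠ 0 ∧ b * x ^ 2 = normPoly a c y₁ y₂ y₃ y₄ := by
  have : IsSepClosed K := IsSepClosure.sep_closed F
  have : Algebra.IsSeparable F K := IsSepClosure.separable
  have : IsGalois F K := IsSepClosure.isGalois
  have h2K : (2 : K) ≠ 0 := by
    simpa only [map_ofNat] using (map_ne_zero (algebraMap F K)).2 h2
  have inj := unitSign_injective h2K
  have char : ∀ m : ZMod 2 × ZMod 2, m + m = 0 := by decide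
  obtain ⟨r, hr0, hr⟩ := exists_semiinvariant (K := K) (fun g => (A g, C g))
    (fun g h => by
      rw [map_mul_of_apply_eq_unitSign_mul h2K hα0 hA,
        map_mul_of_apply_eq_unitSign_mul h2K hγ0 hC, Prod.mk_add_mk])
    (by
      filter_upwards [eventually_apply_eq (F := F) α 1, eventually_apply_eq (F := F) γ 1]
        with u h1 h3
      rw [hA, AlgEquiv.one_apply] at h1
      rw [hC, AlgEquiv.one_apply] at h3
      refine Prod.ext (inj (mul_right_cancel₀ hα0 ?_)) (inj (mul_right_cancel₀ hγ0 ?_)) <;>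
        simpa) φ hφ hφc
  have hy : ∀ g k, g (r k ^ 2) = r (k + (A g, C g)) ^ 2 := by
    intro g k
    have h := hr g (k + (A g, C g))
    rw [add_assoc, char, add_zero] at h
    rw [map_pow, h, mul_pow, sq (unitSign K _), unitSign_mul_self, one_mul]
  have descend : ∀ z : K, (∀ g : K ≃ₐ[F] K, g z = z) → ∃ w, algebraMap F K w = z := fun z hz =>
    (InfiniteGalois.mem_range_algebraMap_iff_fixed z).2 hz
  -- Numerator and `ω` transform by the same character of Galois, so the quotient is fixed.
  have coeff : ∀ (ψ : ZMod 2 × ZMod 2 →+ ZMod 2) (ω : K), ω ≠ 0 →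
      (∀ g : K ≃ₐ[F] K, g ω = unitSign K (ψ (A g, C g)) * ω) →
        ∃ w, algebraMap F K w = (∑ m, unitSign K (ψ m) * r m ^ 2) / (4 * ω) := by
    intro ψ ω hω hψ
    refine descend _ fun g => ?_
    have hsum : g (∑ m, unitSign K (ψ m) * r m ^ 2) =
        unitSign K (ψ (A g, C g)) * ∑ m, unitSign K (ψ m) * r m ^ 2 := by
      rw [map_sum, Finset.mul_sum]
      refine Fintype.sum_equiv (Equiv.addRight (A g, C g)) _ _ fun m => ?_
      rw [map_mul, map_unitSign, hy, Equiv.coe_addRight, map_add, unitSign_add, ← mul_assoc,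
        mul_left_comm, unitSign_mul_self, mul_one]
    rw [map_div₀, hsum, map_mul, hψ, map_ofNat, mul_left_comm,
      mul_div_mul_left _ _ (unitSign_ne_zero _)]
  obtain ⟨y₁, h₁⟩ := coeff 0 1 one_ne_zero (by simp)
  obtain ⟨y₂, h₂⟩ := coeff (AddMonoidHom.fst _ _) α hα0 hA
  obtain ⟨y₃, h₃⟩ := coeff (AddMonoidHom.snd _ _) γ hγ0 hC
  obtain ⟨y₄, h₄⟩ := coeff (AddMonoidHom.fst _ _ + AddMonoidHom.snd _ _) (α * γ)
    (mul_ne_zero hα0 hγ0) (fun g => by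
      rw [map_mul, hA, hC, AddMonoidHom.add_apply, unitSign_add, mul_mul_mul_comm]; rfl)
  obtain ⟨x, hx⟩ := descend ((∏ k, r k) / β) fun g => by
    have hg : g (∏ k, r k) = unitSign K (B g) * ∏ k, r k := by
      rw [← hφs, ← prod_unitSign, ← Finset.prod_mul_distrib, map_prod]
      simp only [← hr]
      exact (Fintype.prod_equiv (Equiv.addRight (A g, C g)) _ _ fun k => rfl).symm
    rw [map_div₀, hg, hB, mul_div_mul_left _ _ (unitSign_ne_zero _)]
  refine ⟨x, y₁, y₂, y₃, y₄, ?_, (algebraMap F K).injective ?_⟩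
  · rw [← map_ne_zero (algebraMap F K), hx]
    exact div_ne_zero (Finset.prod_ne_zero_iff.2 fun k _ => hr0 k) hβ0
  · rw [map_normPoly, ← hα, ← hγ, ← prod_conjugate, map_mul, map_pow, hx, ← hβ, ← mul_pow,
      mul_div_cancel₀ _ hβ0, ← Finset.prod_pow]
    refine Finset.prod_congr rfl fun k _ => ?_
    rw [← exists_conjugate_eq h2K hα0 hγ0 (fun m => r m ^ 2) k, h₁, h₂, h₃, h₄]
    simp

end Cocycles

/-! ### Rational points as solutions of the equation -/

section Points

universe u

variable {F : Type u} [Field F]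

theorem nonempty_point_iff (a b c : Fˣ) :
    Nonempty (Point a b c) ↔ ∃ x y₁ y₂ y₃ y₄ : F, x ≠ 0 ∧
      (b : F) * x ^ 2 = normPoly (a : F) (c : F) y₁ y₂ y₃ y₄ := by
  constructor
  · rintro ⟨s, hs⟩
    -- `Spec` is fully faithful, so a section is a ring map that retracts `F → CoordRing a b c`.
    obtain ⟨f, rfl⟩ := Spec.map_surjective s
    rw [structureMap, ← Spec.map_comp, ← Spec.map_id] at hs
    have hs' := congrArg CommRingCat.Hom.hom (Spec.map_injective hs)
    let ψ : AmbientRing F →+* F := f.hom.comp (Ideal.Quotient.mk _)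
    have hψ : ∀ t : F, ψ (algebraMap F (AmbientRing F) t) = t := fun t =>
      RingHom.congr_fun hs' t
    have heq : ψ (equation a b c) = 0 := by
      have : Ideal.Quotient.mk (Ideal.span {equation a b c}) (equation a b c) = 0 :=
        Ideal.Quotient.eq_zero_iff_mem.2 (Ideal.mem_span_singleton_self _)
      rw [RingHom.comp_apply, this, map_zero]
    refine ⟨ψ (coord F 0), ψ (coord F 1), ψ (coord F 2), ψ (coord F 3), ψ (coord F 4), ?_, ?_⟩
    · exact ((IsLocalization.Away.algebraMap_isUnit _).map ψ).ne_zero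
    · rw [equation, map_sub, sub_eq_zero, map_normPoly, map_mul, map_pow, hψ, hψ, hψ] at heq
      exact heq
  · rintro ⟨x, y₁, y₂, y₃, y₄, hx, h⟩
    let e : MvPolynomial (Fin 5) F →ₐ[F] F := MvPolynomial.aeval ![x, y₁, y₂, y₃, y₄]
    have he : IsUnit (e (MvPolynomial.X 0)) := by simpa [e] using hx
    let ψ : AmbientRing F →+* F := IsLocalization.Away.lift (MvPolynomial.X 0) (g := e.toRingHom) he
    have hψ : ∀ p, ψ (algebraMap (MvPolynomial (Fin 5) F) (AmbientRing F) p) = e p :=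
      fun p => IsLocalization.Away.lift_eq _ he p
    have hψF : ∀ t : F, ψ (algebraMap F (AmbientRing F) t) = t := fun t => by
      rw [IsScalarTower.algebraMap_apply F (MvPolynomial (Fin 5) F), hψ, AlgHom.commutes]; rfl
    have heq : ∀ t ∈ Ideal.span {equation a b c}, ψ t = 0 := by
      intro t ht
      obtain ⟨w, rfl⟩ := Ideal.mem_span_singleton.1 ht
      have : ψ (equation a b c) = 0 := by
        rw [equation, map_sub, sub_eq_zero, map_normPoly, map_mul, map_pow, hψF, hψF, hψF]
        simpa [coord, hψ, e] using h
      rw [map_mul, this, zero_mul]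
    let f : CoordRing a b c →+* F := Ideal.Quotient.lift _ ψ heq
    refine ⟨⟨Spec.map (CommRingCat.ofHom f), ?_⟩⟩
    rw [structureMap, ← Spec.map_comp, ← Spec.map_id]
    congr 1
    ext t
    exact hψF t

end Points

end SplittingVariety

/-! ### The Kummer character and the conclusion -/

theorem Kummer.apply_eq_unitSign_cochain {F Fs : Type*} [Field F] [Field Fs] [Algebra F Fs]
    [IsSepClosure F Fs] (a : Fˣ) (r : Fs) (hr : r ^ 2 = algebraMap F Fs a) (g : Fs ≃ₐ[F] Fs) :
    g r = unitSign Fs (cochain a r hr ![g]) * r := by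
  have hr0 : r ≠ 0 := by
    rintro rfl
    exact (map_ne_zero (algebraMap F Fs)).2 a.ne_zero (by simpa using hr.symm)
  change g r = unitSign Fs (sign Fs (g r / r)) * r
  rw [unitSign_sign, div_mul_cancel₀ _ hr0]
  rw [div_pow, ← map_pow, hr, AlgEquiv.commutes]
  exact div_self ((map_ne_zero (algebraMap F Fs)).2 a.ne_zero)

theorem theorem2 {F : Type*} [Field F] (hF : ringChar F ≠ 2)
    (Fs : Type*) [Field Fs] [Algebra F Fs] [IsSepClosure F Fs] (a b c : Fˣ) :
    Nonempty (SplittingVariety.Point a b c) ↔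
      ContCochain.MasseyDefined
          (Kummer.kappa Fs hF a) (Kummer.kappa Fs hF b) (Kummer.kappa Fs hF c) ∧
        0 ∈ ContCochain.massey
          (Kummer.kappa Fs hF a) (Kummer.kappa Fs hF b) (Kummer.kappa Fs hF c) := by
  have h2 : (2 : F) ≠ 0 := Ring.two_ne_zero hF
  have root : ∀ d : Fˣ, (Kummer.exists_sqrt Fs hF d).choose ≠ 0 := fun d h0 => by
    have h := (Kummer.exists_sqrt Fs hF d).choose_spec
    rw [h0, zero_pow two_ne_zero] at h
    exact (map_ne_zero (algebraMap F Fs)).2 d.ne_zero h.symm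
  have sgn := fun (d : Fˣ) g => Kummer.apply_eq_unitSign_cochain d _
    (Kummer.exists_sqrt Fs hF d).choose_spec g
  -- Definedness is automatic: an element of the Massey product comes from a defining system.
  rw [and_iff_right_of_imp fun ⟨D, _⟩ => ⟨D⟩, SplittingVariety.nonempty_point_iff]
  refine Iff.trans ?_ (ContCochain.zero_mem_massey_iff_exists_cocycle _ _ _).symm
  constructor
  · rintro ⟨x, y₁, y₂, y₃, y₄, hx, h⟩
    exact SplittingVariety.exists_cocycle_of_solution h2
      (Kummer.exists_sqrt Fs hF a).choose_spec (Kummer.exists_sqrt Fs hF b).choose_spec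
      (Kummer.exists_sqrt Fs hF c).choose_spec (root a) (root b) (root c) (sgn a) (sgn b) (sgn c)
      hx h
  · rintro ⟨φ, hφc, hφ, hφs⟩
    exact SplittingVariety.exists_solution_of_cocycle h2
      (Kummer.exists_sqrt Fs hF a).choose_spec (Kummer.exists_sqrt Fs hF b).choose_spec
      (Kummer.exists_sqrt Fs hF c).choose_spec (root a) (root b) (root c) (sgn a) (sgn b) (sgn c)
      φ hφc hφ hφs
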